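/- Let $n\ge 1$ and let ${\bf X}=(X_1,\dots,X_n)\sim\mathcal N({\bf 0}_n,\mathbf I_n)$. Let $\vec{\bf X}=(X_{(1)},\dots,X_{(n)})$ be ${\bf X}$ sorted in ascending order, so that $X_{(1)}\le\dots\le X_{(n)}$, let $\mathsf{Var}(\vec{\bf X})=\mathbb E\big[\|\vec{\bf X}-\mathbb E[\vec{\bf X}]\|^2\big]$ with $\|\cdot\|$ the Euclidean norm, and let $\Phi^{-1}$ be the quantile function (inverse cumulative distribution function) of the standard normal distribution. Then all these moments are finite, for every $i\in\{1,\dots,n\}$ $$\left|\mathbb E[X_{(i)}]-\Phi^{-1}\!\left(\frac{i}{n+1}\right)\right|\le\sqrt{\frac{\pi}{2}}\,\sqrt{\frac{2}{i}+\frac{2}{n+1-i}+\left|\frac1i-\frac{1}{2(n+1-i)}\right|^2},$$ and $$\left|\mathsf{Var}(\vec{\bf X})-\left(n-\sum_{i=1}^n\left(\Phi^{-1}\!\left(\frac{i}{n+1}\right)\right)^2\right)\right|\le 2\sqrt{18(n+1)\,\frac{3\pi}{2}\left(2\log n+\frac1n+1\right)}+\frac{3\pi}{2}\left(2\log n+\frac1n+1\right),$$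 where $\log$ is the natural logarithm. -/

import Mathlib

open MeasureTheory ProbabilityTheory

noncomputable section

/-- The vector `x` rearranged in ascending order. Its coordinate with (zero-based) index `k` is the
`(k + 1)`-st smallest entry of `x`. -/
def sortedVec {n : ℕ} (x : EuclideanSpace ℝ (Fin n)) : EuclideanSpace ℝ (Fin n) :=
  WithLp.toLp 2 (fun k => x (Tuple.sort (fun j => x j) k))

/-- The quantile function `Φ⁻¹` of the standard normal distribution: `normalQuantile p` is the
infimum of all `x` with `p ≤ Φ x`. For `0 < p < 1` it is the unique `x` with `Φ x = p`. -/
def normalQuantile (p : ℝ) : ℝ :=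
  sInf {x : ℝ | p ≤ cdf (gaussianReal 0 1) x}

/-- The (total) variance `𝔼 ‖Y - 𝔼 Y‖²` of a random vector `Y`. -/
def vecVariance {Ω : Type*} [MeasurableSpace Ω] {n : ℕ} (Y : Ω → EuclideanSpace ℝ (Fin n))
    (P : Measure Ω) : ℝ :=
  ∫ ω, ‖Y ω - ∫ ω', Y ω' ∂P‖ ^ 2 ∂P

end

/-! The log-odds log(Φ/(1 − Φ)) has derivative φ/(Φ(1 − Φ)), which a Mills ratio bound keeps above
1/√(π/2). Hence |x − q| is at most √(π/2) times the absolute log of the ratio of the odds at x and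
q, and log² y ≤ y + 1/y − 2 turns this into a bound on (x − q)² linear in the odds and the inverse
odds (`sq_sub_le_normalOdds`).

Odds suit order statistics: multiplying the density of the i-th one by the odds gives a multiple of
the density of the next, so the mean odds are i/(n − i) and the mean inverse odds (n + 1 − i)/(i −
1). The point Φ⁻¹(i/(n + 1)) has odds i/(n + 1 − i), and for 1 < i < n everything cancels down to
(π/2)(1/(i − 1) + 1/(n − i)). For i = 1 and i = n one of these means is infinite; there the mean is
bounded from each side by a first-order argument, and reflection reduces i = n to i = 1.

Sorting preserves the norm, so the variance is n minus the sum of the squared means. Replacing means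
by quantiles is a Cauchy–Schwarz estimate, the summed squared errors being a multiple of the
harmonic number. -/

section

open Filter Topology Set

/-! ### The standard normal distribution and its quantiles -/

/-- The distribution function of the standard normal distribution. -/
noncomputable abbrev normalCDF : ℝ → ℝ := cdf (gaussianReal 0 1)

/-- The density of the standard normal distribution. -/
noncomputable abbrev normalPDF : ℝ → ℝ := gaussianPDFReal 0 1

lemma normalPDF_eq (x : ℝ) : normalPDF x = (√(2 * Real.pi))⁻¹ * Real.exp (-x ^ 2 / 2) := by
  simp [normalPDF, gaussianPDFReal_def]

lemma normalPDF_pos (x : ℝ) : 0 < normalPDF x := gaussianPDFReal_pos _ _ _ one_ne_zero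

lemma hasDerivAt_normalPDF (x : ℝ) : HasDerivAt normalPDF (-x * normalPDF x) x := by
  have h : HasDerivAt (fun y : ℝ => (√(2 * Real.pi))⁻¹ * Real.exp (-y ^ 2 / 2))
      ((√(2 * Real.pi))⁻¹ * (Real.exp (-x ^ 2 / 2) * (-(2 * x) / 2))) x := by
    have h1 : HasDerivAt (fun y : ℝ => -y ^ 2 / 2) (-(2 * x) / 2) x := by
      simpa using ((hasDerivAt_pow 2 x).neg.div_const 2)
    exact h1.exp.const_mul _
  have e : normalPDF = fun y : ℝ => (√(2 * Real.pi))⁻¹ * Real.exp (-y ^ 2 / 2) :=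
    funext normalPDF_eq
  rw [e]
  convert h using 1
  ring

lemma continuous_normalPDF : Continuous normalPDF :=
  continuous_iff_continuousAt.2 fun x => (hasDerivAt_normalPDF x).continuousAt

lemma normalCDF_eq_integral (x : ℝ) : normalCDF x = ∫ t in Iic x, normalPDF t := by
  rw [normalCDF, cdf_eq_real, measureReal_def, gaussianReal_apply_eq_integral _ one_ne_zero,
    ENNReal.toReal_ofReal]
  exact setIntegral_nonneg measurableSet_Iic fun t _ => (normalPDF_pos t).le

lemma hasDerivAt_normalCDF (x : ℝ) : HasDerivAt normalCDF (normalPDF x) x := by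
  have e : normalCDF = fun y => normalCDF 0 + ∫ t in (0 : ℝ)..y, normalPDF t := by
    funext y
    rw [← intervalIntegral.integral_Iic_sub_Iic (integrable_gaussianPDFReal 0 1).integrableOn
      (integrable_gaussianPDFReal 0 1).integrableOn, ← normalCDF_eq_integral,
      ← normalCDF_eq_integral]
    ring
  rw [e]
  exact (intervalIntegral.integral_hasDerivAt_right
    (continuous_normalPDF.intervalIntegrable _ _)
    (continuous_normalPDF.stronglyMeasurableAtFilter _ _)
    continuous_normalPDF.continuousAt).const_add _

lemma continuous_normalCDF : Continuous normalCDF :=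
  continuous_iff_continuousAt.2 fun x => (hasDerivAt_normalCDF x).continuousAt

lemma strictMono_normalCDF : StrictMono normalCDF :=
  strictMono_of_deriv_pos fun x => by
    rw [(hasDerivAt_normalCDF x).deriv]; exact normalPDF_pos x

lemma normalCDF_pos (x : ℝ) : 0 < normalCDF x :=
  (cdf_nonneg _ (x - 1)).trans_lt (strictMono_normalCDF (by linarith))

lemma normalCDF_lt_one (x : ℝ) : normalCDF x < 1 :=
  (strictMono_normalCDF (show x < x + 1 by linarith)).trans_le (cdf_le_one _ _)

/-- The density is even, so Φ(−y) + Φ(y) has zero derivative; its limit at infinity is 1. -/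
lemma normalCDF_neg (x : ℝ) : normalCDF (-x) = 1 - normalCDF x := by
  have hc : ∀ y, HasDerivAt (fun y => normalCDF (-y) + normalCDF y) 0 y := by
    intro y
    have := ((hasDerivAt_normalCDF (-y)).comp y (hasDerivAt_neg y)).add (hasDerivAt_normalCDF y)
    exact this.congr_deriv (by rw [normalPDF_eq, normalPDF_eq]; ring_nf)
  have hconst : ∀ y, normalCDF (-y) + normalCDF y = normalCDF (-x) + normalCDF x := fun y =>
    is_const_of_deriv_eq_zero (fun y => (hc y).differentiableAt) (fun y => (hc y).deriv) y x
  have hlim : Tendsto (fun y => normalCDF (-y) + normalCDF y) atTop (𝓝 (0 + 1)) :=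
    ((tendsto_cdf_atBot _).comp tendsto_neg_atTop_atBot).add (tendsto_cdf_atTop _)
  have := tendsto_nhds_unique (hlim.congr hconst) tendsto_const_nhds
  linarith

lemma normalCDF_zero : normalCDF 0 = 1 / 2 := by
  have := normalCDF_neg 0
  rw [neg_zero] at this
  linarith

lemma normalCDF_normalQuantile {p : ℝ} (h0 : 0 < p) (h1 : p < 1) :
    normalCDF (normalQuantile p) = p := by
  obtain ⟨a, ha⟩ := ((tendsto_cdf_atBot (gaussianReal 0 1)).eventually_lt_const h0).exists
  obtain ⟨b, hb⟩ := ((tendsto_cdf_atTop (gaussianReal 0 1)).eventually_const_lt h1).exists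
  obtain ⟨x, hx⟩ := mem_range_of_exists_le_of_exists_ge continuous_normalCDF ⟨a, ha.le⟩ ⟨b, hb.le⟩
  have : {y : ℝ | p ≤ cdf (gaussianReal 0 1) y} = Ici x := by
    ext y
    rw [mem_ofPred_eq, mem_Ici, ← hx]
    exact strictMono_normalCDF.le_iff_le
  rw [normalQuantile, this, csInf_Ici, hx]

lemma normalQuantile_one_sub {p : ℝ} (h0 : 0 < p) (h1 : p < 1) :
    normalQuantile (1 - p) = -normalQuantile p := by
  apply strictMono_normalCDF.injective
  rw [normalCDF_normalQuantile (by linarith) (by linarith), normalCDF_neg,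
    normalCDF_normalQuantile h0 h1]

/-! ### Mills ratio and log-odds -/

lemma tendsto_normalPDF_atBot : Tendsto normalPDF atBot (𝓝 0) := by
  have h : Tendsto (fun x : ℝ => -x ^ 2 / 2) atBot atBot := by
    have h2 : Tendsto (fun x : ℝ => x ^ 2) atBot atTop := by
      simpa [sq] using (tendsto_id (α := ℝ) (x := atBot)).atBot_mul_atBot₀ tendsto_id
    exact (tendsto_neg_atTop_atBot.comp h2).atBot_div_const (by norm_num)
  have := (Real.tendsto_exp_atBot.comp h).const_mul (√(2 * Real.pi))⁻¹
  rw [mul_zero] at this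
  exact this.congr fun x => (normalPDF_eq x).symm

lemma sqrt_pi_half_pos : 0 < √(Real.pi / 2) := Real.sqrt_pos.2 (by positivity)

lemma sqrt_pi_half_mul_inv : √(Real.pi / 2) * (√(2 * Real.pi))⁻¹ = 1 / 2 := by
  have h : √(2 * Real.pi) = 2 * √(Real.pi / 2) := by
    rw [show 2 * Real.pi = 2 ^ 2 * (Real.pi / 2) by ring, Real.sqrt_mul (by norm_num),
      Real.sqrt_sq (by norm_num)]
  rw [h]
  have := sqrt_pi_half_pos
  field_simp

/-- A Mills ratio bound. -/
lemma normalCDF_le_mul_normalPDF {x : ℝ} (hx : x ≤ 0) :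
    normalCDF x ≤ √(Real.pi / 2) * normalPDF x := by
  set c := √(Real.pi / 2) with hc
  have hc0 : 0 < c := sqrt_pi_half_pos
  set h : ℝ → ℝ := fun y => c * normalPDF y - normalCDF y with hh
  have hd : ∀ y, HasDerivAt h (normalPDF y * (-(c * y) - 1)) y := fun y => by
    exact (((hasDerivAt_normalPDF y).const_mul c).sub (hasDerivAt_normalCDF y)).congr_deriv
      (by ring)
  have hcont : Continuous h := continuous_iff_continuousAt.2 fun y => (hd y).continuousAt
  suffices 0 ≤ h x by simp only [hh] at this; linarith
  -- The derivative of `h` changes sign only at −1/c: `h` rises from its limit 0 at −∞, then falls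
  -- to `h 0 = 0`, the constant c being chosen so that c φ(0) = Φ(0).
  rcases le_total x (-1 / c) with hx1 | hx1
  · have hm : MonotoneOn h (Iic (-1 / c)) := by
      refine monotoneOn_of_deriv_nonneg (convex_Iic _) hcont.continuousOn
        (fun y _ => (hd y).differentiableAt.differentiableWithinAt) fun y hy => ?_
      rw [interior_Iic, mem_Iio, lt_div_iff₀ hc0] at hy
      rw [(hd y).deriv]
      exact mul_nonneg (normalPDF_pos y).le (by linarith)
    have hl : Tendsto h atBot (𝓝 0) := by
      simpa using (tendsto_normalPDF_atBot.const_mul c).sub (tendsto_cdf_atBot (gaussianReal 0 1))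
    refine le_of_tendsto hl ?_
    filter_upwards [eventually_le_atBot x] with y hy
    exact hm (hy.trans hx1) hx1 hy
  · have hm : AntitoneOn h (Icc (-1 / c) 0) := by
      refine antitoneOn_of_deriv_nonpos (convex_Icc _ _) hcont.continuousOn
        (fun y _ => (hd y).differentiableAt.differentiableWithinAt) fun y hy => ?_
      rw [interior_Icc, mem_Ioo, div_lt_iff₀ hc0] at hy
      rw [(hd y).deriv]
      exact mul_nonpos_of_nonneg_of_nonpos (normalPDF_pos y).le (by linarith)
    have h0 : h 0 = 0 := by
      simp only [hh, normalCDF_zero, normalPDF_eq]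
      have := sqrt_pi_half_mul_inv
      rw [← hc] at this
      simpa [sub_eq_zero] using this
    rw [← h0]
    exact hm ⟨hx1, hx⟩ ⟨hx1.trans hx, le_rfl⟩ hx

lemma normalPDF_neg (x : ℝ) : normalPDF (-x) = normalPDF x := by
  rw [normalPDF_eq, normalPDF_eq, neg_sq]

/-- This is the lower bound 1/√(π/2) on the slope of the log-odds. Symmetry reduces it to x ≤ 0,
where the factor 1 − Φ ≤ 1 is discarded. -/
lemma normalCDF_mul_one_sub_le (x : ℝ) :
    normalCDF x * (1 - normalCDF x) ≤ √(Real.pi / 2) * normalPDF x := by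
  have h0 := normalCDF_pos x
  have h1 := normalCDF_lt_one x
  rcases le_total x 0 with hx | hx
  · have := normalCDF_le_mul_normalPDF hx
    nlinarith
  · have := normalCDF_le_mul_normalPDF (neg_nonpos.2 hx)
    rw [normalCDF_neg, normalPDF_neg] at this
    nlinarith

/-- The odds `Φ x / (1 - Φ x)`. -/
noncomputable def normalOdds (x : ℝ) : ℝ := normalCDF x / (1 - normalCDF x)

lemma normalOdds_pos (x : ℝ) : 0 < normalOdds x :=
  div_pos (normalCDF_pos x) (sub_pos.2 (normalCDF_lt_one x))

lemma hasDerivAt_log_normalOdds (x : ℝ) : HasDerivAt (fun y => Real.log (normalOdds y))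
    (normalPDF x / (normalCDF x * (1 - normalCDF x))) x := by
  have h0 := normalCDF_pos x
  have h1 := sub_pos.2 (normalCDF_lt_one x)
  have hd := hasDerivAt_normalCDF x
  have h := (hd.log h0.ne').sub ((hd.const_sub 1).log h1.ne')
  have e : (fun y => Real.log (normalOdds y)) =
      fun y => Real.log (normalCDF y) - Real.log (1 - normalCDF y) := by
    funext y
    rw [normalOdds, Real.log_div (normalCDF_pos y).ne' (sub_pos.2 (normalCDF_lt_one y)).ne']
  rw [e]
  exact h.congr_deriv (by field_simp; ring)

/-- The identity grows at most `√(π / 2)` times as fast as the log-odds. -/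
lemma sub_le_mul_log_normalOdds {x q : ℝ} (h : q ≤ x) :
    x - q ≤ √(Real.pi / 2) * Real.log (normalOdds x / normalOdds q) := by
  have hd : ∀ y, HasDerivAt (fun y => √(Real.pi / 2) * Real.log (normalOdds y) - y)
      (√(Real.pi / 2) * (normalPDF y / (normalCDF y * (1 - normalCDF y))) - 1) y := fun y =>
    ((hasDerivAt_log_normalOdds y).const_mul _).sub (hasDerivAt_id y)
  have hm : Monotone fun y => √(Real.pi / 2) * Real.log (normalOdds y) - y := by
    refine monotone_of_deriv_nonneg (fun y => (hd y).differentiableAt) fun y => ?_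
    rw [(hd y).deriv, ← mul_div_assoc, sub_nonneg, one_le_div
      (mul_pos (normalCDF_pos y) (sub_pos.2 (normalCDF_lt_one y)))]
    exact normalCDF_mul_one_sub_le y
  have := hm h
  simp only at this
  rw [Real.log_div (normalOdds_pos x).ne' (normalOdds_pos q).ne']
  linarith

/-- For y = exp s the right side is 4 sinh²(s/2), and |sinh t| ≥ |t|. -/
lemma sq_log_le {y : ℝ} (hy : 0 < y) : Real.log y ^ 2 ≤ y + y⁻¹ - 2 := by
  obtain ⟨s, rfl⟩ : ∃ s, y = Real.exp s := ⟨Real.log y, (Real.exp_log hy).symm⟩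
  rw [Real.log_exp, ← Real.exp_neg]
  have h : (s / 2) ^ 2 ≤ Real.sinh (s / 2) ^ 2 := by
    rcases le_total 0 (s / 2) with h | h
    · exact pow_le_pow_left₀ h (Real.self_le_sinh_iff.2 h) 2
    · have := Real.sinh_le_self_iff.2 h
      nlinarith
  have e1 : Real.exp s = Real.exp (s / 2) ^ 2 := by rw [← Real.exp_nat_mul]; ring_nf
  have e2 : Real.exp (-s) = Real.exp (-(s / 2)) ^ 2 := by rw [← Real.exp_nat_mul]; ring_nf
  have e3 : Real.exp (s / 2) * Real.exp (-(s / 2)) = 1 := by rw [← Real.exp_add]; simp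
  rw [Real.sinh_eq] at h
  rw [e1, e2]
  linarith

/-- From log y = 2 log √y ≤ 2√y − 2 and (√y − 2)² ≥ 0. It serves the minimum, where the mean of the
inverse odds is not available. -/
lemma log_le_half {y : ℝ} (hy : 0 < y) : Real.log y ≤ y / 2 := by
  have h := Real.log_le_sub_one_of_pos (Real.sqrt_pos.2 hy)
  rw [Real.log_sqrt hy.le] at h
  nlinarith [sq_nonneg (√y - 2), Real.sq_sqrt hy.le]

lemma sq_sub_le_normalOdds (x q : ℝ) : (x - q) ^ 2 ≤
    Real.pi / 2 * (normalOdds x / normalOdds q + normalOdds q / normalOdds x - 2) := by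
  have key : ∀ a b : ℝ, b ≤ a → (a - b) ^ 2 ≤
      Real.pi / 2 * (normalOdds a / normalOdds b + normalOdds b / normalOdds a - 2) := by
    intro a b hab
    have h1 := sub_le_mul_log_normalOdds hab
    have h2 := sq_log_le (div_pos (normalOdds_pos a) (normalOdds_pos b))
    rw [inv_div] at h2
    calc (a - b) ^ 2 ≤ (√(Real.pi / 2) * Real.log (normalOdds a / normalOdds b)) ^ 2 :=
          pow_le_pow_left₀ (sub_nonneg.2 hab) h1 2
      _ = Real.pi / 2 * Real.log (normalOdds a / normalOdds b) ^ 2 := by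
          rw [mul_pow, Real.sq_sqrt (by positivity)]
      _ ≤ _ := mul_le_mul_of_nonneg_left h2 (by positivity)
  rcases le_total q x with h | h
  · exact key x q h
  · have := key q x h
    linarith [sq_nonneg (x - q), show (x - q) ^ 2 = (q - x) ^ 2 by ring]

/-! ### Uniform order statistics and binomial tails -/

/-- The density on `[0, 1]` of the uniform order statistic with zero-based index `m` out of `n`. -/
noncomputable def orderDensity (n m : ℕ) (u : ℝ) : ℝ :=
  n * ((n - 1).choose m * u ^ m * (1 - u) ^ (n - 1 - m))

lemma eval_bernsteinPolynomial (n m : ℕ) (u : ℝ) :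
    (bernsteinPolynomial ℝ n m).eval u = n.choose m * u ^ m * (1 - u) ^ (n - m) := by
  simp [bernsteinPolynomial]

/-- The derivative of each Bernstein polynomial is a difference of consecutive ones of lower degree,
so the sum telescopes. -/
lemma derivative_sum_bernsteinPolynomial (n m : ℕ) :
    Polynomial.derivative (∑ k ∈ Finset.range (m + 1), bernsteinPolynomial ℝ n k) =
      -(n * bernsteinPolynomial ℝ (n - 1) m) := by
  induction m with
  | zero => simp [bernsteinPolynomial.derivative_zero]
  | succ m ih =>
    rw [Finset.sum_range_succ, Polynomial.derivative_add, ih, bernsteinPolynomial.derivative_succ]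
    ring

/-- The probability that at most `m` out of `n` independent events of probability `u` occur. -/
noncomputable def binomialLower (n m : ℕ) (u : ℝ) : ℝ :=
  ∑ k ∈ Finset.range (m + 1), n.choose k * u ^ k * (1 - u) ^ (n - k)

lemma hasDerivAt_binomialLower (n m : ℕ) (u : ℝ) :
    HasDerivAt (binomialLower n m) (-orderDensity n m u) u := by
  have h := (∑ k ∈ Finset.range (m + 1), bernsteinPolynomial ℝ n k).hasDerivAt u
  rw [derivative_sum_bernsteinPolynomial] at h
  have e : binomialLower n m =
      fun x => (∑ k ∈ Finset.range (m + 1), bernsteinPolynomial ℝ n k).eval x := by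
    funext x
    simp [binomialLower, Polynomial.eval_finsetSum, eval_bernsteinPolynomial]
  rw [e]
  refine h.congr_deriv ?_
  simp [orderDensity, eval_bernsteinPolynomial]

lemma continuous_binomialLower (n m : ℕ) : Continuous (binomialLower n m) :=
  continuous_iff_continuousAt.2 fun x => (hasDerivAt_binomialLower n m x).continuousAt

lemma binomialLower_zero (n m : ℕ) : binomialLower n m 0 = 1 := by
  rw [binomialLower, Finset.sum_eq_single_of_mem 0 (by simp)]
  · simp
  · intro k _ hk
    simp [hk]

lemma binomialLower_one {n m : ℕ} (h : m < n) : binomialLower n m 1 = 0 := by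
  refine Finset.sum_eq_zero fun k hk => ?_
  rw [Finset.mem_range] at hk
  simp [show n - k ≠ 0 by omega]

lemma orderDensity_nonneg {n m : ℕ} {u : ℝ} (h0 : 0 ≤ u) (h1 : u ≤ 1) :
    0 ≤ orderDensity n m u := by
  have : 0 ≤ 1 - u := sub_nonneg.2 h1
  unfold orderDensity
  positivity

lemma continuous_orderDensity (n m : ℕ) : Continuous (orderDensity n m) := by
  unfold orderDensity
  fun_prop

lemma orderDensity_one_sub {n m : ℕ} (h : m < n) (u : ℝ) :
    orderDensity n (n - 1 - m) (1 - u) = orderDensity n m u := by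
  rw [orderDensity, orderDensity, Nat.choose_symm (by omega),
    show n - 1 - (n - 1 - m) = m by omega]
  ring

/-- The odds move one factor from 1 − u to u; the constant is the ratio of consecutive binomial
coefficients. This makes all odds moments explicit. -/
lemma orderDensity_mul_odds {n m : ℕ} (h : m + 1 < n) {u : ℝ} (h1 : u ≠ 1) :
    orderDensity n m u * (u / (1 - u)) =
      ((m + 1 : ℝ) / ((n : ℝ) - 1 - m)) * orderDensity n (m + 1) u := by
  obtain ⟨r, rfl⟩ : ∃ r, n = m + r + 2 := ⟨n - m - 2, by omega⟩
  have hu : 1 - u ≠ 0 := sub_ne_zero.2 h1.symm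
  have hc := Nat.choose_succ_right_eq (m + r + 1) m
  rw [show m + r + 1 - m = r + 1 by omega] at hc
  have hc' : ((m + r + 1).choose (m + 1) : ℝ) * (m + 1) = (m + r + 1).choose m * (r + 1) := by
    exact_mod_cast hc
  have hr : ((m + r + 2 : ℕ) : ℝ) - 1 - m = r + 1 := by push_cast; ring
  rw [hr, orderDensity, orderDensity, show m + r + 2 - 1 = m + r + 1 by omega,
    show m + r + 1 - m = r + 1 by omega, show m + r + 1 - (m + 1) = r by omega]
  have : (r : ℝ) + 1 ≠ 0 := by positivity
  field_simp
  linear_combination (-u ^ (m + 1) * (1 - u) ^ (r + 1) : ℝ) * hc'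

/-! ### Laws of normal order statistics -/

/-- The density, with respect to the standard normal distribution, of the order statistic with
zero-based index `m` out of `n` independent standard normal variables. -/
noncomputable def normalOrderDensity (n m : ℕ) (x : ℝ) : ℝ := orderDensity n m (normalCDF x)

lemma normalOrderDensity_nonneg (n m : ℕ) (x : ℝ) : 0 ≤ normalOrderDensity n m x :=
  orderDensity_nonneg (normalCDF_pos x).le (normalCDF_lt_one x).le

lemma continuous_normalOrderDensity (n m : ℕ) : Continuous (normalOrderDensity n m) :=
  (continuous_orderDensity n m).comp continuous_normalCDF

lemma normalOrderDensity_neg {n m : ℕ} (h : m < n) (x : ℝ) :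
    normalOrderDensity n m (-x) = normalOrderDensity n (n - 1 - m) x := by
  rw [normalOrderDensity, normalCDF_neg, ← orderDensity_one_sub h, sub_sub_cancel,
    normalOrderDensity]

lemma normalOrderDensity_mul_odds {n m : ℕ} (h : m + 1 < n) (x : ℝ) :
    normalOrderDensity n m x * normalOdds x =
      ((m + 1 : ℝ) / ((n : ℝ) - 1 - m)) * normalOrderDensity n (m + 1) x :=
  orderDensity_mul_odds h (normalCDF_lt_one x).ne

lemma exists_bound_normalOrderDensity (n m : ℕ) : ∃ C, ∀ x, ‖normalOrderDensity n m x‖ ≤ C := by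
  obtain ⟨C, hC⟩ := isCompact_Icc.exists_bound_of_continuousOn
    (continuous_orderDensity n m).continuousOn (s := Icc 0 1)
  exact ⟨C, fun x => hC _ ⟨(normalCDF_pos x).le, (normalCDF_lt_one x).le⟩⟩

lemma integrable_mul_normalOrderDensity {f : ℝ → ℝ} (hf : Integrable f (gaussianReal 0 1))
    (n m : ℕ) : Integrable (fun x => f x * normalOrderDensity n m x) (gaussianReal 0 1) := by
  obtain ⟨C, hC⟩ := exists_bound_normalOrderDensity n m
  exact hf.mul_bdd (c := C) (continuous_normalOrderDensity n m).aestronglyMeasurable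
    (Eventually.of_forall hC)

lemma integrable_normalOrderDensity (n m : ℕ) :
    Integrable (normalOrderDensity n m) (gaussianReal 0 1) := by
  simpa using integrable_mul_normalOrderDensity (integrable_const (1 : ℝ)) n m

lemma setIntegral_gaussianReal (f : ℝ → ℝ) {s : Set ℝ} (hs : MeasurableSet s) :
    ∫ x in s, f x ∂gaussianReal 0 1 = ∫ x in s, f x * normalPDF x := by
  rw [← integral_indicator hs, integral_gaussianReal_eq_integral_smul one_ne_zero,
    ← integral_indicator hs]
  refine integral_congr_ae (Eventually.of_forall fun x => ?_)
  by_cases hx : x ∈ s <;> simp [hx, mul_comm]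

/-- The integrand is the derivative of −`binomialLower n m` ∘ Φ, which tends to 0 at +∞ because m <
n. -/
lemma setIntegral_Ioi_normalOrderDensity {n m : ℕ} (h : m < n) (t : ℝ) :
    ∫ x in Ioi t, normalOrderDensity n m x ∂gaussianReal 0 1 =
      binomialLower n m (normalCDF t) := by
  rw [setIntegral_gaussianReal _ measurableSet_Ioi]
  have hd : ∀ x ∈ Ici t, HasDerivAt (fun y => -binomialLower n m (normalCDF y))
      (normalOrderDensity n m x * normalPDF x) x := fun x _ =>
    ((hasDerivAt_binomialLower n m (normalCDF x)).comp x (hasDerivAt_normalCDF x)).neg.congr_deriv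
      (by simp [normalOrderDensity])
  rw [integral_Ioi_of_hasDerivAt_of_nonneg' (l := 0) hd
    fun x _ => mul_nonneg (normalOrderDensity_nonneg n m x) (normalPDF_pos x).le]
  · ring
  · have := ((continuous_binomialLower n m).tendsto 1).comp (tendsto_cdf_atTop (gaussianReal 0 1))
    rw [binomialLower_one h] at this
    simpa using this.neg

lemma integral_normalOrderDensity {n m : ℕ} (h : m < n) :
    ∫ x, normalOrderDensity n m x ∂gaussianReal 0 1 = 1 := by
  have h1 : Tendsto (fun k : ℕ => ∫ x in Ioi (-(k : ℝ)), normalOrderDensity n m x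
      ∂gaussianReal 0 1) atTop (𝓝 (∫ x in ⋃ k : ℕ, Ioi (-(k : ℝ)), normalOrderDensity n m x
      ∂gaussianReal 0 1)) := by
    refine tendsto_setIntegral_of_monotone (fun _ => measurableSet_Ioi) ?_
      (integrable_normalOrderDensity n m).integrableOn
    intro a b hab
    exact Ioi_subset_Ioi (by simpa using hab)
  have hU : ⋃ k : ℕ, Ioi (-(k : ℝ)) = univ := by
    refine eq_univ_of_forall fun x => mem_iUnion.2 ?_
    obtain ⟨k, hk⟩ := exists_nat_gt (-x)
    exact ⟨k, by rw [mem_Ioi]; linarith⟩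
  rw [hU, setIntegral_univ] at h1
  simp only [setIntegral_Ioi_normalOrderDensity h] at h1
  have h2 : Tendsto (fun k : ℕ => binomialLower n m (normalCDF (-(k : ℝ)))) atTop (𝓝 1) := by
    have := ((continuous_binomialLower n m).tendsto 0).comp (tendsto_cdf_atBot (gaussianReal 0 1))
    rw [binomialLower_zero] at this
    exact this.comp (tendsto_neg_atTop_atBot.comp tendsto_natCast_atTop_atTop)
  exact tendsto_nhds_unique h1 h2

/-- The law of the order statistic with zero-based index `m` out of `n` independent standard normal
variables. -/
noncomputable def normalOrderLaw (n m : ℕ) : Measure ℝ :=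
  (gaussianReal 0 1).withDensity fun x => ENNReal.ofReal (normalOrderDensity n m x)

lemma normalOrderLaw_apply {n m : ℕ} {s : Set ℝ} (hs : MeasurableSet s) :
    normalOrderLaw n m s =
      ENNReal.ofReal (∫ x in s, normalOrderDensity n m x ∂gaussianReal 0 1) := by
  rw [normalOrderLaw, withDensity_apply _ hs, ofReal_integral_eq_lintegral_ofReal
    (integrable_normalOrderDensity n m).integrableOn
    (Eventually.of_forall fun x => normalOrderDensity_nonneg n m x)]

lemma isProbabilityMeasure_normalOrderLaw {n m : ℕ} (h : m < n) :
    IsProbabilityMeasure (normalOrderLaw n m) :=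
  ⟨by rw [normalOrderLaw_apply MeasurableSet.univ, setIntegral_univ,
    integral_normalOrderDensity h, ENNReal.ofReal_one]⟩

lemma integral_normalOrderLaw (n m : ℕ) (f : ℝ → ℝ) :
    ∫ x, f x ∂normalOrderLaw n m = ∫ x, f x * normalOrderDensity n m x ∂gaussianReal 0 1 := by
  rw [normalOrderLaw, integral_withDensity_eq_integral_toReal_smul
    (continuous_normalOrderDensity n m).measurable.ennreal_ofReal (by simp)]
  refine integral_congr_ae (Eventually.of_forall fun x => ?_)
  simp [ENNReal.toReal_ofReal (normalOrderDensity_nonneg n m x), mul_comm]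

lemma integrable_normalOrderLaw_iff (n m : ℕ) (f : ℝ → ℝ) :
    Integrable f (normalOrderLaw n m) ↔
      Integrable (fun x => f x * normalOrderDensity n m x) (gaussianReal 0 1) := by
  rw [normalOrderLaw, integrable_withDensity_iff_integrable_smul'
    (continuous_normalOrderDensity n m).measurable.ennreal_ofReal (by simp)]
  refine integrable_congr (Eventually.of_forall fun x => ?_)
  simp [ENNReal.toReal_ofReal (normalOrderDensity_nonneg n m x), mul_comm]

/-! ### The sorted Gaussian vector -/

section sortedVec

variable {n : ℕ}

/-- Counting entries at most t is insensitive to permutation, so events about the sorted vector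
become events about the original one. The strict inequality reflects the zero-based index. -/
lemma lt_card_iff_sortedVec_le (x : EuclideanSpace ℝ (Fin n)) (k : Fin n) (t : ℝ) :
    (k : ℕ) < (Finset.univ.filter fun j => x j ≤ t).card ↔ sortedVec x k ≤ t := by
  have h := Tuple.lt_card_le_iff_apply_le_of_monotone (j := k) (a := t)
    (f := fun j => x (Tuple.sort (fun j => x j) j)) (Tuple.monotone_sort fun j => x j)
  have hc : (Finset.univ.filter fun j => x (Tuple.sort (fun j => x j) j) ≤ t).card =
      (Finset.univ.filter fun j => x j ≤ t).card :=
    Finset.card_equiv (Tuple.sort fun j => x j) (by simp)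
  rw [← hc]
  exact h

lemma norm_sortedVec (x : EuclideanSpace ℝ (Fin n)) : ‖sortedVec x‖ = ‖x‖ := by
  rw [EuclideanSpace.norm_eq, EuclideanSpace.norm_eq]
  congr 1
  exact Equiv.sum_comp (Tuple.sort fun j => x j) fun j => ‖x j‖ ^ 2

/-- The points whose set of coordinates at most `t` is `S`. -/
def lowerBox (t : ℝ) (S : Finset (Fin n)) : Set (Fin n → ℝ) :=
  univ.pi fun j => if j ∈ S then Iic t else Ioi t

lemma mem_lowerBox {t : ℝ} {S : Finset (Fin n)} {y : Fin n → ℝ} :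
    y ∈ lowerBox t S ↔ (Finset.univ.filter fun j => y j ≤ t) = S := by
  rw [lowerBox, mem_univ_pi, Finset.ext_iff]
  refine forall_congr' fun j => ?_
  by_cases hj : j ∈ S <;> simp [hj]

lemma measurableSet_lowerBox (t : ℝ) (S : Finset (Fin n)) : MeasurableSet (lowerBox t S) :=
  MeasurableSet.univ_pi fun j => by
    split_ifs
    exacts [measurableSet_Iic, measurableSet_Ioi]

lemma measureReal_lowerBox (t : ℝ) (S : Finset (Fin n)) :
    (Measure.pi fun _ : Fin n => gaussianReal 0 1).real (lowerBox t S) =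
      normalCDF t ^ S.card * (1 - normalCDF t) ^ (n - S.card) := by
  rw [lowerBox, measureReal_def, Measure.pi_pi, ENNReal.toReal_prod]
  have h : ∀ j, (gaussianReal 0 1 (if j ∈ S then Iic t else Ioi t)).toReal =
      if j ∈ S then normalCDF t else 1 - normalCDF t := fun j => by
    split_ifs
    · rw [normalCDF, cdf_eq_real, measureReal_def]
    · rw [← compl_Iic, ← measureReal_def, probReal_compl_eq_one_sub measurableSet_Iic,
        normalCDF, cdf_eq_real]
  simp only [h]
  rw [Finset.prod_ite, Finset.prod_const, Finset.prod_const, Finset.filter_mem_eq_inter,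
    Finset.univ_inter, Finset.filter_notMem_eq_sdiff, ← Finset.compl_eq_univ_sdiff,
    Finset.card_compl, Fintype.card_fin]

/-- Splitting by the exact set of coordinates at most t gives disjoint product sets, whose
probabilities depend only on the cardinality of that set and add up to a binomial tail. -/
lemma preimage_sortedVec_Ioi (k : Fin n) (t : ℝ) :
    (fun y : Fin n → ℝ => sortedVec (WithLp.toLp 2 y) k) ⁻¹' Ioi t =
      ⋃ S ∈ (Finset.univ : Finset (Finset (Fin n))).filter (fun S => S.card < (k : ℕ) + 1),
        lowerBox t S := by
  ext y
  have h := lt_card_iff_sortedVec_le (WithLp.toLp 2 y) k t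
  simp only [mem_preimage, mem_Ioi, mem_iUnion, mem_lowerBox, Finset.mem_filter, Finset.mem_univ,
    true_and, exists_prop, exists_eq_right', Nat.lt_succ_iff]
  rw [← not_le, ← h, not_lt]

lemma measurable_sortedVec_apply (k : Fin n) :
    Measurable fun x : EuclideanSpace ℝ (Fin n) => sortedVec x k := by
  have h : Measurable fun y : Fin n → ℝ => sortedVec (WithLp.toLp 2 y) k := by
    refine measurable_of_Ioi fun t => ?_
    rw [preimage_sortedVec_Ioi]
    exact Finset.measurableSet_biUnion _ fun S _ => measurableSet_lowerBox t S
  exact h.comp (WithLp.measurable_ofLp 2 _)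

lemma measurable_sortedVec : Measurable (sortedVec (n := n)) :=
  (WithLp.measurable_toLp 2 _).comp (measurable_pi_lambda _ fun k => measurable_sortedVec_apply k)

lemma measureReal_sortedVec_Ioi (k : Fin n) (t : ℝ) :
    (Measure.pi fun _ : Fin n => gaussianReal 0 1).real
      ((fun y : Fin n → ℝ => sortedVec (WithLp.toLp 2 y) k) ⁻¹' Ioi t) =
      binomialLower n k (normalCDF t) := by
  rw [preimage_sortedVec_Ioi, measureReal_biUnion_finset _ fun S _ => measurableSet_lowerBox t S]
  · simp only [measureReal_lowerBox]
    rw [Finset.sum_filter, ← Finset.powerset_univ]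
    rw [Finset.sum_powerset_apply_card (fun m => if m < (k : ℕ) + 1 then
      normalCDF t ^ m * (1 - normalCDF t) ^ (n - m) else 0), binomialLower]
    simp only [Finset.card_univ, Fintype.card_fin, smul_ite, smul_zero]
    rw [← Finset.sum_filter]
    refine Finset.sum_congr ?_ fun m _ => by rw [nsmul_eq_mul, mul_assoc]
    ext m
    simp only [Finset.mem_filter, Finset.mem_range]
    omega
  · intro S _ T _ hST
    refine Set.disjoint_left.2 fun y hS hT => hST ?_
    rw [mem_lowerBox] at hS hT
    rw [← hS, ← hT]

/-- Both laws give Ioi t the mass `binomialLower n k (normalCDF t)`; complements give agreement on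
all Iic t, which determines a finite measure. -/
lemma hasLaw_sortedVec_apply (k : Fin n) :
    HasLaw (fun x : EuclideanSpace ℝ (Fin n) => sortedVec x k) (normalOrderLaw n k)
      (multivariateGaussian 0 1) := by
  refine ⟨(measurable_sortedVec_apply k).aemeasurable, ?_⟩
  have hm : Measurable fun y : Fin n → ℝ => sortedVec (WithLp.toLp 2 y) k :=
    (measurable_sortedVec_apply k).comp (WithLp.measurable_toLp 2 _)
  rw [multivariateGaussian_zero_one, ← map_pi_eq_stdGaussian,
    Measure.map_map (measurable_sortedVec_apply k) (WithLp.measurable_toLp 2 _)]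
  have := isProbabilityMeasure_normalOrderLaw k.isLt
  have := Measure.isProbabilityMeasure_map (μ := Measure.pi fun _ : Fin n => gaussianReal 0 1)
    hm.aemeasurable
  have hI : ∀ t, (Measure.pi fun _ : Fin n => gaussianReal 0 1).map
      (fun y : Fin n → ℝ => sortedVec (WithLp.toLp 2 y) k) (Ioi t) =
        normalOrderLaw n k (Ioi t) := fun t => by
    rw [normalOrderLaw_apply measurableSet_Ioi, setIntegral_Ioi_normalOrderDensity k.isLt,
      Measure.map_apply hm measurableSet_Ioi, ← measureReal_sortedVec_Ioi,
      ofReal_measureReal]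
  refine Measure.ext_of_Iic _ _ fun t => ?_
  have h := hI t
  rw [← compl_Iic, prob_compl_eq_one_sub measurableSet_Iic,
    prob_compl_eq_one_sub measurableSet_Iic] at h
  exact (ENNReal.sub_right_inj ENNReal.one_ne_top prob_le_one prob_le_one).1 h

variable {Ω : Type*} [MeasurableSpace Ω] {P : Measure Ω} {X : Ω → EuclideanSpace ℝ (Fin n)}

lemma memLp_of_hasLaw (hX : HasLaw X (multivariateGaussian 0 1) P) : MemLp X 2 P := by
  have h : MemLp id 2 (P.map X) := by
    rw [hX.map_eq]
    exact IsGaussian.memLp_two_id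
  exact h.comp_of_map hX.aemeasurable

lemma memLp_sortedVec (hX : HasLaw X (multivariateGaussian 0 1) P) :
    MemLp (fun ω => sortedVec (X ω)) 2 P :=
  (memLp_of_hasLaw hX).of_le
    (measurable_sortedVec.comp_aemeasurable hX.aemeasurable).aestronglyMeasurable
    (Eventually.of_forall fun _ => (norm_sortedVec _).le)

lemma integral_norm_sq (hX : HasLaw X (multivariateGaussian 0 1) P) :
    ∫ ω, ‖X ω‖ ^ 2 ∂P = n := by
  have h : ∀ j : Fin n, HasLaw (fun ω => X ω j) (gaussianReal 0 1) P := fun j => by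
    have := (measurePreserving_eval_multivariateGaussian (μ := (0 : EuclideanSpace ℝ (Fin n)))
      Matrix.PosSemidef.one (i := j)).fun_comp_hasLaw hX
    simpa using this
  have h2 : ∀ j : Fin n, ∫ ω, X ω j ^ 2 ∂P = 1 := fun j => by
    have e := (h j).integral_comp (f := fun x => x ^ 2) (by fun_prop)
    simp only [Function.comp_def] at e
    rw [e]
    have hv := variance_fun_id_gaussianReal (μ := 0) (v := 1)
    rw [variance_of_integral_eq_zero (by fun_prop) integral_id_gaussianReal] at hv
    simpa using hv
  simp only [EuclideanSpace.norm_sq_eq, Real.norm_eq_abs, sq_abs]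
  rw [integral_finsetSum]
  · simp [h2]
  · intro j _
    exact ((memLp_of_hasLaw hX).eval_piLp j).integrable_sq

end sortedVec

/-! ### Moments of order statistics and of their odds -/

lemma integrable_id_normalOrderLaw (n m : ℕ) : Integrable (fun x => x) (normalOrderLaw n m) :=
  (integrable_normalOrderLaw_iff n m _).2
    (integrable_mul_normalOrderDensity IsGaussian.integrable_id n m)

lemma memLp_two_normalOrderLaw (n m : ℕ) : MemLp (fun x => x) 2 (normalOrderLaw n m) := by
  rw [memLp_two_iff_integrable_sq (by fun_prop), integrable_normalOrderLaw_iff]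
  exact integrable_mul_normalOrderDensity
    (IsGaussian.memLp_two_id (μ := gaussianReal 0 1)).integrable_sq n m

lemma integral_id_normalOrderLaw_reflect {n m : ℕ} (h : m < n) :
    ∫ x, x ∂normalOrderLaw n (n - 1 - m) = -∫ x, x ∂normalOrderLaw n m := by
  have hγ : (gaussianReal 0 1).map (fun x : ℝ => -x) = gaussianReal 0 1 := by
    rw [gaussianReal_map_neg, neg_zero]
  rw [integral_normalOrderLaw, integral_normalOrderLaw, ← integral_neg]
  conv_rhs => rw [← hγ]
  have hc : Continuous fun x => -(x * normalOrderDensity n m x) :=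
    (continuous_id.mul (continuous_normalOrderDensity n m)).neg
  rw [integral_map (by fun_prop) hc.aestronglyMeasurable]
  simp only [normalOrderDensity_neg h, neg_mul, neg_neg]

lemma normalOdds_inv_mul {n m : ℕ} (h : m + 1 < n) (x : ℝ) :
    (normalOdds x)⁻¹ * normalOrderDensity n (m + 1) x =
      (((n : ℝ) - 1 - m) / (m + 1)) * normalOrderDensity n m x := by
  have h1 := normalOrderDensity_mul_odds h x
  have ho := normalOdds_pos x
  have hn : (0 : ℝ) < (n : ℝ) - 1 - m := by
    have : ((m + 1 : ℕ) : ℝ) < n := by exact_mod_cast h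
    push_cast at this
    linarith
  have hm : (0 : ℝ) < m + 1 := by positivity
  field_simp
  field_simp at h1
  linarith

lemma integrable_normalOdds {n m : ℕ} (h : m + 1 < n) :
    Integrable normalOdds (normalOrderLaw n m) := by
  rw [integrable_normalOrderLaw_iff]
  simp only [mul_comm (normalOdds _), normalOrderDensity_mul_odds h]
  exact (integrable_normalOrderDensity n (m + 1)).const_mul _

lemma integral_normalOdds {n m : ℕ} (h : m + 1 < n) :
    ∫ x, normalOdds x ∂normalOrderLaw n m = (m + 1 : ℝ) / ((n : ℝ) - 1 - m) := by
  rw [integral_normalOrderLaw]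
  simp only [mul_comm (normalOdds _), normalOrderDensity_mul_odds h]
  rw [integral_const_mul, integral_normalOrderDensity h, mul_one]

lemma integrable_normalOdds_inv {n m : ℕ} (h : m + 1 < n) :
    Integrable (fun x => (normalOdds x)⁻¹) (normalOrderLaw n (m + 1)) := by
  rw [integrable_normalOrderLaw_iff]
  simp only [normalOdds_inv_mul h]
  exact (integrable_normalOrderDensity n m).const_mul _

lemma integral_normalOdds_inv {n m : ℕ} (h : m + 1 < n) :
    ∫ x, (normalOdds x)⁻¹ ∂normalOrderLaw n (m + 1) = ((n : ℝ) - 1 - m) / (m + 1 : ℝ) := by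
  rw [integral_normalOrderLaw]
  simp only [normalOdds_inv_mul h]
  rw [integral_const_mul, integral_normalOrderDensity (by omega), mul_one]

/-- Jensen's inequality, read off from the nonnegativity of the variance of x − q. -/
lemma sq_integral_sub_le {n m : ℕ} (h : m < n) (q : ℝ) :
    ((∫ x, x ∂normalOrderLaw n m) - q) ^ 2 ≤ ∫ x, (x - q) ^ 2 ∂normalOrderLaw n m := by
  have := isProbabilityMeasure_normalOrderLaw h
  have hL : MemLp (fun x => x - q) 2 (normalOrderLaw n m) :=
    (memLp_two_normalOrderLaw n m).sub (memLp_const q)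
  have hv := variance_nonneg (fun x => x - q) (normalOrderLaw n m)
  rw [variance_eq_sub hL, integral_sub (integrable_id_normalOrderLaw n m) (integrable_const q)] at hv
  simpa using hv

lemma normalOdds_normalQuantile {n m : ℕ} (h : m < n) :
    normalOdds (normalQuantile (((m : ℝ) + 1) / (n + 1))) = ((m : ℝ) + 1) / (n - m) := by
  have hn : (m : ℝ) < n := by exact_mod_cast h
  rw [normalOdds, normalCDF_normalQuantile (by positivity)
    (by rw [div_lt_one (by positivity)]; linarith)]
  have : (n : ℝ) - m ≠ 0 := (sub_pos.2 hn).ne'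
  have h2 : 1 - ((m : ℝ) + 1) / (n + 1) = (n - m) / (n + 1) := by field_simp; ring
  rw [h2]
  field_simp

/-- The index m + 1 is neither first nor last, so both the odds and the inverse odds are integrable.
-/
lemma sq_integral_sub_quantile_le_of_interior {n m : ℕ} (h : m + 2 < n) :
    ((∫ x, x ∂normalOrderLaw n (m + 1)) - normalQuantile (((m + 1 : ℕ) + 1 : ℝ) / (n + 1))) ^ 2 ≤
      Real.pi / 2 * (2 / ((m + 1 : ℕ) + 1) + 2 / (n - (m + 1 : ℕ))) := by
  set q := normalQuantile (((m + 1 : ℕ) + 1 : ℝ) / (n + 1)) with hq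
  have ho : normalOdds q = ((m + 1 : ℕ) + 1 : ℝ) / (n - (m + 1 : ℕ)) :=
    normalOdds_normalQuantile (by omega)
  have := isProbabilityMeasure_normalOrderLaw (show m + 1 < n by omega)
  have i1 := (integrable_normalOdds (show m + 1 + 1 < n by omega)).div_const (normalOdds q)
  have i2 := (integrable_normalOdds_inv (show m + 1 < n by omega)).const_mul (normalOdds q)
  have i3 : Integrable (fun x => normalOdds x / normalOdds q + normalOdds q * (normalOdds x)⁻¹)
      (normalOrderLaw n (m + 1)) := i1.add i2
  have hI : ∫ x, Real.pi / 2 * (normalOdds x / normalOdds q + normalOdds q * (normalOdds x)⁻¹ - 2)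
      ∂normalOrderLaw n (m + 1) = Real.pi / 2 * (((m + 1 : ℕ) + 1 : ℝ) / (n - 1 - (m + 1 : ℕ)) /
        normalOdds q + normalOdds q * ((n - 1 - m) / (m + 1 : ℝ)) - 2) := by
    rw [integral_const_mul, integral_sub i3 (integrable_const _), integral_add i1 i2,
      integral_div, integral_const_mul, integral_normalOdds (by omega),
      integral_normalOdds_inv (by omega)]
    simp
  have hle : ∫ x, (x - q) ^ 2 ∂normalOrderLaw n (m + 1) ≤
      ∫ x, Real.pi / 2 * (normalOdds x / normalOdds q + normalOdds q * (normalOdds x)⁻¹ - 2)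
        ∂normalOrderLaw n (m + 1) := by
    refine integral_mono ?_ ((i3.sub (integrable_const _)).const_mul _) fun x => ?_
    · exact ((memLp_two_normalOrderLaw n (m + 1)).sub (memLp_const q)).integrable_sq
    · simpa [div_eq_mul_inv] using sq_sub_le_normalOdds x q
  refine (sq_integral_sub_le (by omega) q).trans (hle.trans (hI.le.trans ?_))
  refine mul_le_mul_of_nonneg_left ?_ (by positivity)
  obtain ⟨r, rfl⟩ : ∃ r, n = m + r + 3 := ⟨n - m - 3, by omega⟩
  rw [ho]
  push_cast
  rw [show (m : ℝ) + r + 3 - 1 - (m + 1) = r + 1 by ring,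
    show (m : ℝ) + r + 3 - (m + 1) = r + 2 by ring, show (m : ℝ) + r + 3 - 1 - m = r + 2 by ring,
    show (m : ℝ) + 1 + 1 = m + 2 by ring]
  -- The two mean ratios are 1 + 1/(r + 1) and 1 + 1/(m + 1), so the −2 removes their leading terms.
  have e : ((m : ℝ) + 2) / (r + 1) / ((m + 2) / (r + 2)) + (m + 2) / (r + 2) * ((r + 2) / (m + 1)) - 2
      = 1 / (m + 1) + 1 / (r + 1) := by
    field_simp
    ring
  rw [e]
  refine add_le_add ?_ ?_ <;>
  · rw [div_le_div_iff₀ (by positivity) (by positivity)]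
    have : (0 : ℝ) ≤ m := by positivity
    have : (0 : ℝ) ≤ r := by positivity
    linarith

/-! ### The extreme order statistics -/

lemma setIntegral_Iic_sub (q : ℝ) :
    ∫ x in Iic q, (q - x) ∂gaussianReal 0 1 = q * normalCDF q + normalPDF q := by
  have hγ : Integrable (fun x : ℝ => x * normalPDF x) := by
    have h : Integrable (fun x : ℝ => x) (gaussianReal 0 1) := IsGaussian.integrable_id
    rw [gaussianReal_of_var_ne_zero _ one_ne_zero, integrable_withDensity_iff_integrable_smul'
      (measurable_gaussianPDF 0 1) (Eventually.of_forall fun _ => gaussianPDF_lt_top)] at h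
    simpa [toReal_gaussianPDF, mul_comm] using h
  have hφ : Integrable normalPDF := integrable_gaussianPDFReal 0 1
  have hφ' : IntegrableOn (fun x => -x * normalPDF x) (Iic q) := by
    simpa only [neg_mul] using! hγ.neg.integrableOn
  have h2 : ∫ x in Iic q, -x * normalPDF x = normalPDF q - 0 :=
    integral_Iic_of_hasDerivAt_of_tendsto' (fun x _ => hasDerivAt_normalPDF x)
      hφ' tendsto_normalPDF_atBot
  rw [setIntegral_gaussianReal _ measurableSet_Iic]
  simp only [sub_eq_add_neg, add_mul]
  rw [integral_add (hφ.const_mul q).integrableOn hφ', h2,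
    integral_const_mul, ← normalCDF_eq_integral, sub_zero]

lemma mul_normalCDF_add_normalPDF_le {q : ℝ} (hq : q ≤ 0) :
    q * normalCDF q + normalPDF q ≤ √(Real.pi / 2) * normalCDF q := by
  set c := √(Real.pi / 2)
  have hd : ∀ y, HasDerivAt (fun y => c * normalCDF y - (y * normalCDF y + normalPDF y))
      (c * normalPDF y - normalCDF y) y := fun y =>
    (((hasDerivAt_normalCDF y).const_mul c).sub
      (((hasDerivAt_id y).mul (hasDerivAt_normalCDF y)).add (hasDerivAt_normalPDF y))).congr_deriv
      (by simp)
  have hm : MonotoneOn (fun y => c * normalCDF y - (y * normalCDF y + normalPDF y)) (Iic 0) := by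
    refine monotoneOn_of_deriv_nonneg (convex_Iic _)
      (fun y _ => (hd y).continuousAt.continuousWithinAt)
      (fun y _ => (hd y).differentiableAt.differentiableWithinAt) fun y hy => ?_
    rw [interior_Iic, mem_Iio] at hy
    rw [(hd y).deriv]
    exact sub_nonneg.2 (normalCDF_le_mul_normalPDF hy.le)
  -- Since −yΦ(y) ≥ 0 for y ≤ 0, this simpler function bounds the monotone one from below, and the
  -- limit of yΦ(y) is not needed.
  have hl : Tendsto (fun y => c * normalCDF y - normalPDF y) atBot (𝓝 0) := by
    simpa using ((tendsto_cdf_atBot (gaussianReal 0 1)).const_mul c).sub tendsto_normalPDF_atBot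
  rw [← sub_nonneg]
  refine le_of_tendsto hl ?_
  filter_upwards [eventually_le_atBot q] with y hy
  have h1 := hm (hy.trans hq) hq hy
  have h2 : y * normalCDF y ≤ 0 :=
    mul_nonpos_of_nonpos_of_nonneg (hy.trans hq) (normalCDF_pos y).le
  simp only at h1
  linarith

lemma normalOrderDensity_zero_le (n : ℕ) (x : ℝ) : normalOrderDensity n 0 x ≤ n := by
  have h0 := normalCDF_pos x
  have h1 := normalCDF_lt_one x
  have := pow_le_one₀ (n := n - 1) (sub_nonneg.2 h1.le) (by linarith : 1 - normalCDF x ≤ 1)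
  simpa [normalOrderDensity, orderDensity] using mul_le_mul_of_nonneg_left this (Nat.cast_nonneg n)

/-- The density of the minimum is at most n, so the left side is at most n times the Gaussian mean
of (q − x)⁺, hence at most √(π/2) · nΦ(q), where nΦ(q) = n/(n + 1). -/
lemma quantile_sub_integral_le {n : ℕ} (h : 0 < n) :
    normalQuantile (1 / (n + 1 : ℝ)) - ∫ x, x ∂normalOrderLaw n 0 ≤ √(Real.pi / 2) := by
  set q := normalQuantile (1 / (n + 1 : ℝ)) with hq
  have hn : (1 : ℝ) ≤ n := by exact_mod_cast h
  have hΦ : normalCDF q = 1 / (n + 1 : ℝ) :=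
    normalCDF_normalQuantile (by positivity) (by rw [div_lt_one (by positivity)]; linarith)
  have hq0 : q ≤ 0 := by
    rw [← strictMono_normalCDF.le_iff_le, hΦ, normalCDF_zero,
      div_le_div_iff₀ (by positivity) (by norm_num)]
    linarith
  have := isProbabilityMeasure_normalOrderLaw h
  have hi : Integrable (fun x : ℝ => q - x) (gaussianReal 0 1) :=
    (integrable_const q).sub IsGaussian.integrable_id
  have e : q - ∫ x, x ∂normalOrderLaw n 0 = ∫ x, (q - x) ∂normalOrderLaw n 0 := by
    rw [integral_sub (integrable_const q) (integrable_id_normalOrderLaw n 0)]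
    simp
  have hle : ∫ x, (q - x) ∂normalOrderLaw n 0 ≤ n * (q * normalCDF q + normalPDF q) := by
    rw [integral_normalOrderLaw, ← setIntegral_Iic_sub, ← integral_const_mul,
      ← integral_indicator measurableSet_Iic]
    refine integral_mono (integrable_mul_normalOrderDensity hi n 0)
      ((hi.const_mul _).indicator measurableSet_Iic) fun x => ?_
    by_cases hx : x ≤ q
    · simp only [indicator_of_mem (mem_Iic.2 hx)]
      rw [mul_comm]
      exact mul_le_mul_of_nonneg_right (normalOrderDensity_zero_le n x) (sub_nonneg.2 hx)
    · simp only [indicator_of_notMem (notMem_Iic.2 (not_le.1 hx))]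
      exact mul_nonpos_of_nonpos_of_nonneg (by linarith) (normalOrderDensity_nonneg n 0 x)
  have hM := mul_normalCDF_add_normalPDF_le hq0
  have hc := sqrt_pi_half_pos
  rw [e]
  refine hle.trans ((mul_le_mul_of_nonneg_left hM (by positivity)).trans ?_)
  rw [hΦ, mul_one_div, ← mul_div_assoc, div_le_iff₀ (by positivity)]
  linarith

/-- By `log_le_half`, x − q is at most √(π/2) times half the ratio of odds, whose mean is n/(n − 1)
≤ 2. -/
lemma integral_sub_quantile_le {n : ℕ} (h : 1 < n) :
    (∫ x, x ∂normalOrderLaw n 0) - normalQuantile (1 / (n + 1 : ℝ)) ≤ √(Real.pi / 2) := by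
  set q := normalQuantile (1 / (n + 1 : ℝ)) with hq
  have hn : (2 : ℝ) ≤ n := by exact_mod_cast h
  have ho : normalOdds q = 1 / n := by
    have := normalOdds_normalQuantile (show 0 < n by omega)
    simpa [hq] using this
  have := isProbabilityMeasure_normalOrderLaw (show 0 < n by omega)
  have hc := sqrt_pi_half_pos
  have e : (∫ x, x ∂normalOrderLaw n 0) - q = ∫ x, (x - q) ∂normalOrderLaw n 0 := by
    rw [integral_sub (integrable_id_normalOrderLaw n 0) (integrable_const q)]
    simp
  have hle : ∫ x, (x - q) ∂normalOrderLaw n 0 ≤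
      ∫ x, √(Real.pi / 2) * (normalOdds x / normalOdds q / 2) ∂normalOrderLaw n 0 := by
    refine integral_mono ((integrable_id_normalOrderLaw n 0).sub (integrable_const q))
      ((((integrable_normalOdds (by omega)).div_const _).div_const _).const_mul _) fun x => ?_
    have hr := div_pos (normalOdds_pos x) (normalOdds_pos q)
    rcases le_total q x with hx | hx
    · exact (sub_le_mul_log_normalOdds hx).trans
        (mul_le_mul_of_nonneg_left (log_le_half hr) hc.le)
    · exact (sub_nonpos.2 hx).trans (by positivity)
  rw [e]
  refine hle.trans ?_
  rw [integral_const_mul, integral_div, integral_div, integral_normalOdds (by omega), ho]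
  refine mul_le_of_le_one_right hc.le ?_
  have : (0 : ℝ) < n - 1 := by linarith
  simp only [Nat.cast_zero, zero_add, sub_zero]
  rw [div_le_one (by norm_num), div_div_eq_mul_div, div_one, div_mul_eq_mul_div,
    div_le_iff₀ this]
  linarith

lemma sq_integral_sub_quantile_zero_le {n : ℕ} (h : 1 < n) :
    ((∫ x, x ∂normalOrderLaw n 0) - normalQuantile (1 / (n + 1 : ℝ))) ^ 2 ≤ Real.pi / 2 := by
  rw [← Real.sq_sqrt (show 0 ≤ Real.pi / 2 by positivity)]
  refine sq_le_sq' ?_ (integral_sub_quantile_le h)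
  linarith [quantile_sub_integral_le (show 0 < n by omega)]

/-- The mean of a normal order statistic is close to the corresponding quantile. -/
theorem sq_integral_sub_quantile_le {n m : ℕ} (h : m < n) :
    ((∫ x, x ∂normalOrderLaw n m) - normalQuantile (((m : ℝ) + 1) / (n + 1))) ^ 2 ≤
      Real.pi / 2 * (2 / ((m : ℝ) + 1) + 2 / (n - m)) := by
  have hmn : (0 : ℝ) < n - m := sub_pos.2 (by exact_mod_cast h)
  rcases Nat.lt_or_ge (m + 1) n with h1 | h1
  · rcases m with _ | m
    · have := sq_integral_sub_quantile_zero_le h1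
      simp only [Nat.cast_zero, zero_add, sub_zero, div_one]
      refine this.trans (le_mul_of_one_le_right (by positivity) ?_)
      have : (0 : ℝ) ≤ 2 / n := by positivity
      linarith
    · exact sq_integral_sub_quantile_le_of_interior h1
  · obtain rfl : n = m + 1 := by omega
    have hr := integral_id_normalOrderLaw_reflect (show 0 < m + 1 by omega)
    rw [show m + 1 - 1 - 0 = m by omega] at hr
    have hq : normalQuantile (((m : ℝ) + 1) / ((m + 1 : ℕ) + 1)) =
        -normalQuantile (1 / ((m + 1 : ℕ) + 1)) := by
      rw [← normalQuantile_one_sub (by positivity)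
        (by rw [div_lt_one (by positivity)]; push_cast; linarith [(m.cast_nonneg : (0 : ℝ) ≤ m)])]
      congr 1
      push_cast
      field_simp
      ring
    rw [hr, hq]
    -- For n = 1 the reflection identities force both the mean and the quantile to vanish.
    rcases m with _ | m
    · have h0 : ∫ x, x ∂normalOrderLaw (0 + 1) 0 = 0 := by linarith
      have hq0 : normalQuantile (1 / ((0 + 1 : ℕ) + 1)) = 0 := by
        norm_num at hq ⊢
        linarith
      rw [h0, hq0]
      norm_num
      positivity
    · have := sq_integral_sub_quantile_zero_le (show 1 < m + 1 + 1 by omega)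
      rw [neg_sub_neg, ← neg_sub, neg_sq]
      refine this.trans (le_mul_of_one_le_right (by positivity) ?_)
      have : (0 : ℝ) ≤ 2 / (((m + 1 : ℕ) : ℝ) + 1) := by positivity
      push_cast at this ⊢
      rw [show (m : ℝ) + 1 + 1 - (m + 1) = 1 by ring]
      linarith

/-! ### From means to the variance -/

lemma vecVariance_eq {Ω : Type*} [MeasurableSpace Ω] {P : Measure Ω} [IsProbabilityMeasure P]
    {n : ℕ} {Y : Ω → EuclideanSpace ℝ (Fin n)} (hY : MemLp Y 2 P) :
    vecVariance Y P = ∫ ω, ‖Y ω‖ ^ 2 ∂P - ∑ k, (∫ ω, Y ω k ∂P) ^ 2 := by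
  have hk : ∀ k, MemLp (fun ω => Y ω k) 2 P := fun k => hY.eval_piLp k
  have hm : ∀ k, (∫ ω, Y ω ∂P) k = ∫ ω, Y ω k ∂P := fun k =>
    eval_integral_piLp (fun i => (hk i).integrable one_le_two) k
  have hv : ∀ k, ∫ ω, (Y ω k - ∫ ω', Y ω' k ∂P) ^ 2 ∂P =
      ∫ ω, Y ω k ^ 2 ∂P - (∫ ω, Y ω k ∂P) ^ 2 := fun k => by
    rw [← variance_eq_integral (hk k).aemeasurable, variance_eq_sub (hk k)]
    rfl
  simp only [vecVariance, EuclideanSpace.norm_sq_eq, Real.norm_eq_abs, sq_abs, PiLp.sub_apply, hm]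
  rw [integral_finsetSum, integral_finsetSum, ← Finset.sum_sub_distrib]
  · exact Finset.sum_congr rfl fun k _ => hv k
  · exact fun k _ => (hk k).integrable_sq
  · exact fun k _ => ((hk k).sub (memLp_const _)).integrable_sq

lemma vecVariance_nonneg {Ω : Type*} [MeasurableSpace Ω] (P : Measure Ω) {n : ℕ}
    (Y : Ω → EuclideanSpace ℝ (Fin n)) : 0 ≤ vecVariance Y P :=
  integral_nonneg fun _ => by positivity

/-- Expand q² − a² = (a − q)² − 2a(a − q) and apply Cauchy–Schwarz. The sum of a² is kept because
nonnegativity of the variance will bound it by n. -/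
lemma abs_sum_sq_sub_sum_sq_le {ι : Type*} (s : Finset ι) (a q : ι → ℝ) :
    |∑ k ∈ s, q k ^ 2 - ∑ k ∈ s, a k ^ 2| ≤
      2 * √((∑ k ∈ s, a k ^ 2) * ∑ k ∈ s, (a k - q k) ^ 2) + ∑ k ∈ s, (a k - q k) ^ 2 := by
  have e : ∑ k ∈ s, q k ^ 2 - ∑ k ∈ s, a k ^ 2 =
      ∑ k ∈ s, (a k - q k) ^ 2 - 2 * ∑ k ∈ s, a k * (a k - q k) := by
    rw [Finset.mul_sum, ← Finset.sum_sub_distrib, ← Finset.sum_sub_distrib]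
    exact Finset.sum_congr rfl fun k _ => by ring
  have hD : 0 ≤ ∑ k ∈ s, (a k - q k) ^ 2 := Finset.sum_nonneg fun k _ => sq_nonneg _
  have hCS : |∑ k ∈ s, a k * (a k - q k)| ≤
      √((∑ k ∈ s, a k ^ 2) * ∑ k ∈ s, (a k - q k) ^ 2) :=
    Real.abs_le_sqrt (Finset.sum_mul_sq_le_sq_mul_sq _ _ _)
  rw [e]
  refine (abs_sub _ _).trans ?_
  rw [abs_of_nonneg hD, abs_mul, abs_two]
  linarith

/-- The harmonic number is at most 1 + log n, so for n ≥ 2 it is enough that 2 log 2 ≥ 1; n = 1 is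
checked directly. -/
lemma four_mul_sum_inv_le {n : ℕ} (hn : 1 ≤ n) :
    4 * ∑ k ∈ Finset.range n, 1 / ((k : ℝ) + 1) ≤ 3 * (2 * Real.log n + 1 / n + 1) := by
  have h := harmonic_le_one_add_log n
  have e : ((harmonic n : ℚ) : ℝ) = ∑ k ∈ Finset.range n, 1 / ((k : ℝ) + 1) := by
    simp [harmonic]
  rw [e] at h
  rcases hn.eq_or_lt with rfl | hn
  · norm_num
  · have h2 : Real.log 2 ≤ Real.log n := Real.log_le_log (by norm_num) (by exact_mod_cast hn)
    have h3 : (0 : ℝ) ≤ 1 / n := by positivity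
    linarith [Real.log_two_gt_d9]

lemma sum_two_div_add_two_div (n : ℕ) :
    ∑ k ∈ Finset.range n, (2 / ((k : ℝ) + 1) + 2 / ((n : ℝ) - k)) =
      4 * ∑ k ∈ Finset.range n, 1 / ((k : ℝ) + 1) := by
  have h : ∑ k ∈ Finset.range n, 2 / ((n : ℝ) - k) = ∑ k ∈ Finset.range n, 2 / ((k : ℝ) + 1) := by
    rw [← Finset.sum_range_reflect]
    refine Finset.sum_congr rfl fun k hk => ?_
    rw [Finset.mem_range] at hk
    have : ((n - 1 - k : ℕ) : ℝ) = n - 1 - k := by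
      rw [Nat.cast_sub (by omega), Nat.cast_sub (by omega), Nat.cast_one]
    rw [this]
    congr 1
    ring
  rw [Finset.sum_add_distrib, h, Finset.mul_sum, ← Finset.sum_add_distrib]
  exact Finset.sum_congr rfl fun k _ => by ring

end

/-! ### The main theorem -/

theorem theorem8 {Ω : Type*} [MeasurableSpace Ω] (P : Measure Ω) [IsProbabilityMeasure P]
    (n : ℕ) (hn : 1 ≤ n) (X : Ω → EuclideanSpace ℝ (Fin n))
    (hX : HasLaw X (multivariateGaussian 0 1) P) :
    (∀ (i : ℕ) (h1 : 1 ≤ i) (h2 : i ≤ n),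
      Integrable (fun ω => sortedVec (X ω) ⟨i - 1, by omega⟩) P ∧
      |(∫ ω, sortedVec (X ω) ⟨i - 1, by omega⟩ ∂P) - normalQuantile ((i : ℝ) / ((n : ℝ) + 1))| ≤
        √(Real.pi / 2) *
          √(2 / (i : ℝ) + 2 / ((n : ℝ) + 1 - (i : ℝ)) +
            |1 / (i : ℝ) - 1 / (2 * ((n : ℝ) + 1 - (i : ℝ)))| ^ 2)) ∧
    (MemLp (fun ω => sortedVec (X ω)) 2 P ∧
      |vecVariance (fun ω => sortedVec (X ω)) P -
          ((n : ℝ) - ∑ i ∈ Finset.Icc 1 n, normalQuantile ((i : ℝ) / ((n : ℝ) + 1)) ^ 2)| ≤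
        2 * √(18 * ((n : ℝ) + 1) * (3 * Real.pi / 2) *
            (2 * Real.log (n : ℝ) + 1 / (n : ℝ) + 1)) +
          3 * Real.pi / 2 * (2 * Real.log (n : ℝ) + 1 / (n : ℝ) + 1)) := by
  have hL := memLp_sortedVec hX
  have hmean : ∀ k : Fin n, ∫ ω, sortedVec (X ω) k ∂P = ∫ x, x ∂normalOrderLaw n k := fun k =>
    ((hasLaw_sortedVec_apply k).fun_comp hX).integral_eq
  refine ⟨fun i h1 h2 => ⟨(hL.eval_piLp _).integrable one_le_two, ?_⟩, hL, ?_⟩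
  · obtain ⟨m, rfl⟩ : ∃ m, i = m + 1 := ⟨i - 1, by omega⟩
    have hm : m < n := by omega
    rw [hmean]
    have h := Real.abs_le_sqrt (sq_integral_sub_quantile_le hm)
    rw [Real.sqrt_mul (by positivity)] at h
    simp only [Nat.add_sub_cancel]
    push_cast
    rw [show (n : ℝ) + 1 - (m + 1) = n - m by ring]
    refine h.trans (mul_le_mul_of_nonneg_left (Real.sqrt_le_sqrt ?_) (Real.sqrt_nonneg _))
    -- The squared difference in the stated bound is pure slack.
    exact le_add_of_nonneg_right (by positivity)
  · set a : ℕ → ℝ := fun m => ∫ x, x ∂normalOrderLaw n m with ha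
    set q : ℕ → ℝ := fun m => normalQuantile (((m : ℝ) + 1) / (n + 1)) with hq
    set L := 2 * Real.log (n : ℝ) + 1 / (n : ℝ) + 1 with hLdef
    have hvar : vecVariance (fun ω => sortedVec (X ω)) P =
        n - ∑ k ∈ Finset.range n, a k ^ 2 := by
      rw [vecVariance_eq hL, ← Fin.sum_univ_eq_sum_range (fun k => a k ^ 2)]
      simp only [norm_sortedVec, integral_norm_sq hX, hmean, ha]
    have hsq : ∑ i ∈ Finset.Icc 1 n, normalQuantile ((i : ℝ) / ((n : ℝ) + 1)) ^ 2 =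
        ∑ k ∈ Finset.range n, q k ^ 2 := by
      rw [Finset.range_eq_Ico, ← Finset.Ico_add_one_right_eq_Icc,
        ← Finset.sum_Ico_add' (fun i : ℕ => normalQuantile ((i : ℝ) / ((n : ℝ) + 1)) ^ 2) 0 n 1]
      simp [hq]
    have hA : ∑ k ∈ Finset.range n, a k ^ 2 ≤ n := by
      have := vecVariance_nonneg P fun ω => sortedVec (X ω)
      linarith
    have hD : ∑ k ∈ Finset.range n, (a k - q k) ^ 2 ≤ 3 * Real.pi / 2 * L := by
      calc ∑ k ∈ Finset.range n, (a k - q k) ^ 2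
          ≤ ∑ k ∈ Finset.range n, Real.pi / 2 * (2 / ((k : ℝ) + 1) + 2 / ((n : ℝ) - k)) :=
            Finset.sum_le_sum fun k hk => sq_integral_sub_quantile_le (Finset.mem_range.1 hk)
        _ = Real.pi / 2 * (4 * ∑ k ∈ Finset.range n, 1 / ((k : ℝ) + 1)) := by
            rw [← Finset.mul_sum, sum_two_div_add_two_div]
        _ ≤ Real.pi / 2 * (3 * L) :=
            mul_le_mul_of_nonneg_left (four_mul_sum_inv_le hn) (by positivity)
        _ = 3 * Real.pi / 2 * L := by ring
    have hD0 : 0 ≤ ∑ k ∈ Finset.range n, (a k - q k) ^ 2 :=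
      Finset.sum_nonneg fun k _ => sq_nonneg _
    rw [hvar, hsq, sub_sub_sub_cancel_left]
    refine (abs_sum_sq_sub_sum_sq_le _ a q).trans (add_le_add
      (mul_le_mul_of_nonneg_left (Real.sqrt_le_sqrt ?_) zero_le_two) hD)
    rw [mul_assoc _ (3 * Real.pi / 2)]
    -- Here n ≤ 18(n + 1) is all that is used of the stated constant.
    exact mul_le_mul (hA.trans (by linarith [(n.cast_nonneg : (0 : ℝ) ≤ n)])) hD hD0 (by positivity)
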